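/- Let $n, p \ge 0$ be integers and $x = (x_1,\dots,x_n)$ independent variables. For a partition $\lambda$ with at most $n$ parts let $$s_\lambda(x)=\frac{\det\bigl(x_j^{\lambda_i+n-i}\bigr)_{1\le i,j\le n}}{\det\bigl(x_j^{n-i}\bigr)_{1\le i,j\le n}}$$ be the Schur polynomial, and put $s_\lambda(x)=0$ if $\lambda$ has more than $n$ parts. For a partition $\mu$ let $|\mu|$ be its number of boxes, $\mu'$ its conjugate, $r(\mu)$ the number of boxes on the main diagonal of its Young diagram, and $\mu^{(p)}$ the partition whose diagram is obtained by lengthening each of the first $r(\mu)$ rows by $p$ boxes; that is, if $\mu=(\alpha_1,\dots,\alpha_r\,|\,\beta_1,\dots,\beta_r)$ in Frobenius notation, then $\mu^{(p)}=(\alpha_1+p,\dots,\alpha_r+p\,|\,\beta_1,\dots,\beta_r)$. Then $$\frac{\displaystyle\sum_{\mu:\ \mu=\mu'}(-1)^{\frac12(|\mu|+r(\mu))}\,s_{\mu^{(p)}}(x)}{\displaystyle\prod_{1\le i\le n}(1-x_i)\prod_{1\le i<j\le n}(1-x_ix_j)}\;=\;\sum_{\lambda}s_\lambda(x),$$ where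 the sum on the left is over all self-conjugate partitions and the sum on the right is over all partitions $\lambda$ with at most $p$ columns (that is, $\lambda_1\le p$); in both sums only finitely many terms are nonzero. -/

import Mathlib

/-- The rank `r(μ)` of a Young diagram: the number of boxes on its main diagonal. -/
def YoungDiagram.diagRank (μ : YoungDiagram) : ℕ :=
  (μ.cells.filter fun c => c.1 = c.2).card

/-- The number of boxes strictly to the right of the diagonal box `(i, i)`. -/
def YoungDiagram.diagArm (μ : YoungDiagram) (i : ℕ) : ℕ := μ.rowLen i - (i + 1)

/-- The number of boxes strictly below the diagonal box `(i, i)`. -/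
def YoungDiagram.diagLeg (μ : YoungDiagram) (i : ℕ) : ℕ := μ.colLen i - (i + 1)

/-- The arm `p`-augmented diagram `μ^(p)`: every row that meets the main diagonal is made longer
by `p` boxes. In Frobenius notation `(α | β)` becomes `(α + p | β)`; see `diag_mem_armAugment`,
`diagArm_armAugment` and `diagLeg_armAugment`. -/
def YoungDiagram.armAugment (p : ℕ) (μ : YoungDiagram) : YoungDiagram where
  cells := (Finset.range (μ.colLen 0) ×ˢ Finset.range (μ.rowLen 0 + p)).filter
    fun c => c.2 < μ.rowLen c.1 + if (c.1, c.1) ∈ μ then p else 0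
  isLowerSet := by
    rintro ⟨i, j⟩ ⟨i', j'⟩ ⟨h1, h2⟩ h
    simp only [Finset.coe_filter, Finset.mem_product, Finset.mem_range, Set.mem_ofPred_eq] at *
    have h3 := μ.rowLen_anti i' i h1
    have h4 : (i, i) ∈ μ → (i', i') ∈ μ := μ.up_left_mem h1 h1
    refine ⟨⟨by omega, by omega⟩, ?_⟩
    split_ifs at h ⊢ <;> first | omega | tauto

theorem YoungDiagram.mem_armAugment {p : ℕ} {μ : YoungDiagram} {i j : ℕ} :
    (i, j) ∈ μ.armAugment p ↔ j < μ.rowLen i + if (i, i) ∈ μ then p else 0 := by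
  rw [← YoungDiagram.mem_cells]
  simp only [YoungDiagram.armAugment, Finset.mem_filter, Finset.mem_product, Finset.mem_range,
    and_iff_right_iff_imp]
  intro h
  have h3 := μ.rowLen_anti 0 i (Nat.zero_le i)
  refine ⟨?_, by split_ifs at h <;> omega⟩
  rw [← YoungDiagram.mem_iff_lt_colLen]
  by_cases hi : (i, i) ∈ μ
  · exact μ.up_left_mem le_rfl (Nat.zero_le i) hi
  · rw [if_neg hi] at h
    exact YoungDiagram.mem_iff_lt_rowLen.2 (by omega)

/-- `μ` and `μ^(p)` have the same diagonal boxes. -/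
theorem YoungDiagram.diag_mem_armAugment {p : ℕ} {μ : YoungDiagram} {i : ℕ} :
    (i, i) ∈ μ.armAugment p ↔ (i, i) ∈ μ := by
  rw [YoungDiagram.mem_armAugment]
  by_cases hi : (i, i) ∈ μ
  · have := YoungDiagram.mem_iff_lt_rowLen.1 hi
    simp only [hi, if_true, iff_true]
    omega
  · have h := mt YoungDiagram.mem_iff_lt_rowLen.2 hi
    simp only [hi, if_false, iff_false]
    omega

theorem YoungDiagram.rowLen_armAugment (p : ℕ) (μ : YoungDiagram) (i : ℕ) :
    (μ.armAugment p).rowLen i = μ.rowLen i + if (i, i) ∈ μ then p else 0 := by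
  refine eq_of_forall_lt_iff fun j => ?_
  rw [← YoungDiagram.mem_iff_lt_rowLen, YoungDiagram.mem_armAugment]

theorem YoungDiagram.diagArm_armAugment {p : ℕ} {μ : YoungDiagram} {i : ℕ} (h : (i, i) ∈ μ) :
    (μ.armAugment p).diagArm i = μ.diagArm i + p := by
  have := YoungDiagram.mem_iff_lt_rowLen.1 h
  rw [YoungDiagram.diagArm, YoungDiagram.diagArm, YoungDiagram.rowLen_armAugment, if_pos h]
  omega

theorem YoungDiagram.diagLeg_armAugment {p : ℕ} {μ : YoungDiagram} {i : ℕ} (h : (i, i) ∈ μ) :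
    (μ.armAugment p).diagLeg i = μ.diagLeg i := by
  have key : (μ.armAugment p).colLen i = μ.colLen i := by
    refine eq_of_forall_lt_iff fun k => ?_
    rw [← YoungDiagram.mem_iff_lt_colLen, ← YoungDiagram.mem_iff_lt_colLen,
      YoungDiagram.mem_armAugment, YoungDiagram.mem_iff_lt_rowLen (μ := μ) (i := k) (j := i)]
    by_cases hk : (k, k) ∈ μ
    · rw [if_pos hk]
      have h1 := YoungDiagram.mem_iff_lt_rowLen.1 h
      have h2 := YoungDiagram.mem_iff_lt_rowLen.1 hk
      rcases le_total k i with hki | hki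
      · have := μ.rowLen_anti k i hki
        constructor <;> intro <;> omega
      · constructor <;> intro <;> omega
    · rw [if_neg hk, add_zero]
  rw [YoungDiagram.diagLeg, YoungDiagram.diagLeg, key]

/-- The field of rational functions `ℚ(x_1, …, x_n)`, as the fraction field of
`ℤ[x_1, …, x_n]`. -/
abbrev RatFunField (n : ℕ) : Type := FractionRing (MvPolynomial (Fin n) ℤ)

/-- The variable `x_i`. -/
noncomputable def ratVar (n : ℕ) (i : Fin n) : RatFunField n :=
  algebraMap (MvPolynomial (Fin n) ℤ) (RatFunField n) (MvPolynomial.X i)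

/-- The alternant `det (x_j ^ (ν_i + n - i))`, `1 ≤ i, j ≤ n` (indices are shifted to start
at `0`), for `ν` a diagram with at most `n` rows. -/
noncomputable def alternant (n : ℕ) (ν : YoungDiagram) : RatFunField n :=
  Matrix.det (Matrix.of fun i j : Fin n => ratVar n j ^ (ν.rowLen i + (n - 1 - (i : ℕ))))

/-- The Schur polynomial `s_ν(x_1, …, x_n)` as a quotient of determinants; it is `0` if `ν` has
more than `n` rows. -/
noncomputable def schurPoly (n : ℕ) (ν : YoungDiagram) : RatFunField n :=
  if ν.colLen 0 ≤ n then alternant n ν / alternant n ⊥ else 0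

/-- The denominator in the definition of `schurPoly` (the Vandermonde determinant) is not zero. -/
theorem alternant_bot_ne_zero (n : ℕ) : alternant n ⊥ ≠ 0 := by
  have hinj : Function.Injective (ratVar n) := fun a b h =>
    MvPolynomial.X_injective (IsFractionRing.injective (MvPolynomial (Fin n) ℤ) (RatFunField n) h)
  have hrow : ∀ i, (⊥ : YoungDiagram).rowLen i = 0 := fun i => by
    by_contra hne
    exact YoungDiagram.notMem_bot (i, 0)
      (YoungDiagram.mem_iff_lt_rowLen.2 (Nat.pos_of_ne_zero hne))
  have h1 : (Matrix.of fun i j : Fin n =>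
        ratVar n j ^ ((⊥ : YoungDiagram).rowLen i + (n - 1 - (i : ℕ)))) =
      (Matrix.vandermonde (ratVar n)).transpose.submatrix Fin.revPerm id := by
    ext i j
    simp only [hrow, Matrix.of_apply, Matrix.submatrix_apply, Matrix.transpose_apply,
      Matrix.vandermonde_apply, Fin.revPerm_apply, Fin.val_rev, id_eq]
    congr 1
    omega
  rw [alternant, h1, Matrix.det_permute, Matrix.det_transpose]
  refine mul_ne_zero ?_ (Matrix.det_vandermonde_ne_zero_iff.2 hinj)
  rcases Int.units_eq_one_or (Equiv.Perm.sign (Fin.revPerm : Equiv.Perm (Fin n))) with h | h <;>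
    simp [h]

/-!
Multiply the identity by the Vandermonde determinant and by the denominator
`D = ∏ (1 - x_i) * ∏ (1 - x_i x_j)`. Both sides then equal the determinant
`W n m = det (x_j ^ (n - i) - x_j ^ (m + i - 1))` with `m = n + p` (`weylNumerator`).

For the sum over self-conjugate diagrams this is an expansion by multilinearity
(`AlternatingMap.map_sub_eq_sum_selfConj`): for every `i` one chooses one of the two monomials, and
the values `i - 1` for which the second one is chosen form the set `α` of a self-conjugate
`μ = (α | α)`. The proof treats one `i` at a time; choosing the second monomial for the largest `i`
corresponds to adding a first hook to `μ`.

For the sum over bounded diagrams (`sum_genAlternant_mul_littlewoodDenom`), let `A n p` be the sum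
of the alternants of all diagrams in an `n × p` box. A diagram with `n + 1` nonzero rows is a
narrower diagram with a full column added. For a diagram with fewer rows the last row of the
alternant consists of ones, and Laplace expansion along it gives
`A (n+1) p - (∏ x_i) A (n+1) (p-1) = ∑ j, ± (∏ i ≠ j, x_i) A n p`, with `A n p` evaluated at the
variables other than `x_j`. The matching recursion for `W` is `weylNumerator_succ_sub`.
To obtain it, `W` is expanded over all ways to invert some of the variables, each term being a
Vandermonde product. Comparing the terms in which the variables outside a set `T` are inverted
leaves the partial fraction identity
`∑ j ∈ T, (1 - x_j) * ∏ i ∈ T \ {j}, x_i (1 - x_i x_j) / (x_i - x_j) = 1 - ∏ i ∈ T, x_i`,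
which says that a divided difference of order exceeding the degree of a polynomial vanishes. The
recursion starts from `p = -1`, where `W (n + 1) n = 0`.
-/

/-! ### A partial fraction identity -/

open Polynomial in
/-- A partial fraction identity: the divided difference of `∏ b ∈ T, (1 - b * X)`, a polynomial of
degree at most `#T`, at the `#T + 2` nodes `T ∪ {0, -1}` vanishes. -/
theorem Finset.sum_one_sub_mul_prod_div_sub {K : Type*} [Field K] [DecidableEq K] (T : Finset K)
    (h0 : 0 ∉ T) (h1 : -1 ∉ T) :
    ∑ a ∈ T, (1 - a) * ∏ b ∈ T.erase a, (b * (1 - b * a) / (b - a)) = 1 - ∏ b ∈ T, b := by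
  have hc : (0 : K) ≠ -1 := by simp
  set f : K[X] := ∏ b ∈ T, (1 - C b * X) with hf
  have hdeg : f.degree ≤ (T.card : WithBot ℕ) := by
    rw [hf, Polynomial.degree_prod]
    refine (Finset.sum_le_card_nsmul T _ 1 fun b _ => ?_).trans (by simp)
    compute_degree
  have hfe : ∀ a, f.eval a = ∏ b ∈ T, (1 - b * a) := fun a => by
    simp [hf, Polynomial.eval_prod]
  have hn0 : (0 : K) ∉ insert (-1) T := by simp [h0]
  have hcard : (insert 0 (insert (-1) T)).card = T.card + 2 := by
    rw [Finset.card_insert_of_notMem hn0, Finset.card_insert_of_notMem h1]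
  have key := Lagrange.coeff_eq_sum (s := insert 0 (insert (-1) T)) (v := id)
    Function.injective_id.injOn (P := f) (by
      rw [hcard]; exact hdeg.trans_lt (by exact_mod_cast (by omega)))
  rw [hcard, Polynomial.coeff_eq_zero_of_degree_lt
    (hdeg.trans_lt (by exact_mod_cast (by omega))), Finset.sum_insert hn0,
    Finset.sum_insert h1] at key
  have hb0 : ∀ b ∈ T, b ≠ 0 := fun b hb h => h0 (h ▸ hb)
  have hb1 : ∀ b ∈ T, b + 1 ≠ 0 := fun b hb h => h1 (eq_neg_of_add_eq_zero_left h ▸ hb)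
  have he : ∏ b ∈ T, b ≠ 0 := Finset.prod_ne_zero_iff.2 hb0
  have t0 : f.eval (id 0) / ∏ j ∈ (insert 0 (insert (-1) T)).erase 0, (id (0 : K) - id j)
      = (-1) ^ T.card / ∏ b ∈ T, b := by
    have : ∏ b ∈ T, (id (0 : K) - id b) = (-1) ^ T.card * ∏ b ∈ T, b := by
      rw [← Finset.prod_const, ← Finset.prod_mul_distrib]
      exact Finset.prod_congr rfl fun b _ => by simp
    rw [Finset.erase_insert hn0, Finset.prod_insert h1, hfe, this]
    simp only [id, mul_zero, sub_zero, Finset.prod_const_one, sub_neg_eq_add, zero_add, one_mul]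
    rcases neg_one_pow_eq_or K T.card with h | h <;> rw [h] <;> field_simp
  have t1 : f.eval (id (-1)) / ∏ j ∈ (insert 0 (insert (-1) T)).erase (-1), (id (-1 : K) - id j)
      = - (-1) ^ T.card := by
    rw [Finset.erase_insert_of_ne hc, Finset.erase_insert h1,
      Finset.prod_insert h0, hfe]
    have : ∏ b ∈ T, (id (-1 : K) - id b) = (-1) ^ T.card * ∏ b ∈ T, (1 - b * id (-1)) := by
      rw [← Finset.prod_const, ← Finset.prod_mul_distrib]
      exact Finset.prod_congr rfl fun b _ => by simp; ring
    have hne : ∏ b ∈ T, (1 - b * id (-1)) ≠ 0 := Finset.prod_ne_zero_iff.2 fun b hb => by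
      simpa [add_comm] using hb1 b hb
    rw [this]
    generalize ∏ b ∈ T, (1 - b * id (-1)) = P at hne ⊢
    simp only [id]
    rcases neg_one_pow_eq_or K T.card with h | h <;> rw [h] <;> field_simp <;> ring
  have t2 : ∀ a ∈ T, f.eval (id a) / ∏ j ∈ (insert 0 (insert (-1) T)).erase a, (id a - id j)
      = - ((-1) ^ T.card / ∏ b ∈ T, b) *
        ((1 - a) * ∏ b ∈ T.erase a, (b * (1 - b * a) / (b - a))) := by
    intro a ha
    have ha0 := hb0 a ha
    have ha1 := hb1 a ha
    have e1 : (insert 0 (insert (-1) T)).erase a = insert 0 (insert (-1) (T.erase a)) := by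
      rw [Finset.erase_insert_of_ne (Ne.symm ha0), Finset.erase_insert_of_ne]
      rintro rfl; exact h1 ha
    rw [e1, Finset.prod_insert (by simp [h0]), Finset.prod_insert (by simp [h1]), hfe,
      ← Finset.mul_prod_erase T _ ha, ← Finset.mul_prod_erase T (fun b => b) ha,
      Finset.prod_div_distrib, Finset.prod_mul_distrib]
    have : ∏ b ∈ T.erase a, (id a - id b) = -(-1) ^ T.card * ∏ b ∈ T.erase a, (b - a) := by
      rw [← Finset.card_erase_add_one ha, pow_succ, ← Finset.prod_const]
      simp only [mul_neg, mul_one, neg_neg]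
      rw [← Finset.prod_mul_distrib]
      exact Finset.prod_congr rfl fun b _ => by simp
    have hP : ∏ b ∈ T.erase a, (b - a) ≠ 0 := Finset.prod_ne_zero_iff.2 fun b hb =>
      sub_ne_zero.2 (Finset.ne_of_mem_erase hb)
    have hQ : ∏ b ∈ T.erase a, b ≠ 0 := Finset.prod_ne_zero_iff.2 fun b hb =>
      hb0 b (Finset.mem_of_mem_erase hb)
    rw [this]
    simp only [id, sub_zero, sub_neg_eq_add]
    rcases neg_one_pow_eq_or K T.card with h | h <;> rw [h] <;> field_simp <;> ring
  rw [t0, t1, Finset.sum_congr rfl t2, ← Finset.mul_sum] at key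
  generalize ∑ a ∈ T, (1 - a) * ∏ b ∈ T.erase a, (b * (1 - b * a) / (b - a)) = s at key ⊢
  rcases neg_one_pow_eq_or K T.card with h | h <;> rw [h] at key <;> field_simp at key
  · linear_combination key
  · linear_combination -key

/-! ### Products over pairs of indices -/

/-- A product over the pairs `a < b`, with the pairs that contain `j` split off. -/
theorem Fin.prod_prod_Ioi_succAbove {M : Type*} [CommMonoid M] {n : ℕ}
    (g : Fin (n + 1) → Fin (n + 1) → M) (j : Fin (n + 1)) :
    ∏ a, ∏ b ∈ Finset.Ioi a, g a b =
      (∏ i : Fin n, if j.succAbove i < j then g (j.succAbove i) j else g j (j.succAbove i)) *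
        ∏ a : Fin n, ∏ b ∈ Finset.Ioi a, g (j.succAbove a) (j.succAbove b) := by
  have h : ∀ {k : ℕ} (g : Fin k → Fin k → M) (a : Fin k),
      ∏ b ∈ Finset.Ioi a, g a b = ∏ b, if a < b then g a b else 1 := fun g a => by
    rw [← Finset.prod_filter]
    exact Finset.prod_congr (by ext; simp) fun _ _ => rfl
  simp only [h, h fun a b => g (j.succAbove a) (j.succAbove b)]
  rw [Fin.prod_univ_succAbove _ j, Fin.prod_univ_succAbove _ j, if_neg (lt_irrefl j), one_mul]
  rw [Finset.prod_congr rfl fun i _ => Fin.prod_univ_succAbove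
    (fun b => if j.succAbove i < b then g (j.succAbove i) b else 1) j]
  simp only [Finset.prod_mul_distrib, Fin.succAbove_lt_succAbove_iff]
  rw [← mul_assoc, ← Finset.prod_mul_distrib]
  congr 1
  refine Finset.prod_congr rfl fun i _ => ?_
  rcases lt_or_gt_of_ne (Fin.succAbove_ne j i) with hi | hi
  · simp [hi, hi.not_gt]
  · simp [hi, hi.not_gt]

/-- The sign acquired by a product of differences over all pairs when `j` is put last in each of
its pairs: `n - j` indices exceed `j`. -/
theorem Fin.prod_ite_succAbove_lt {n : ℕ} {R : Type*} [CommRing R] (j : Fin (n + 1)) :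
    (∏ i : Fin n, if j.succAbove i < j then (1 : R) else -1) = (-1) ^ (n + (j : ℕ)) := by
  have h : ∏ i : Fin n, (if j.succAbove i < j then (1 : R) else -1) =
      ∏ i : Fin n, (if (i : ℕ) < j then (1 : R) else -1) :=
    Finset.prod_congr rfl fun i _ => by
      simp only [Fin.succAbove_lt_iff_castSucc_lt]
      rfl
  rw [h, Fin.prod_univ_eq_prod_range (fun i => if i < (j : ℕ) then (1 : R) else -1) n,
    ← Finset.prod_range_mul_prod_Ico _ (Nat.lt_succ_iff.1 j.2),
    Finset.prod_congr rfl fun i hi => if_pos (Finset.mem_range.1 hi),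
    Finset.prod_congr rfl fun i hi => if_neg (Finset.mem_Ico.1 hi).1.not_gt]
  simp only [Finset.prod_const_one, one_mul, Finset.prod_const, Nat.card_Ico]
  have : n + (j : ℕ) = (n - j) + 2 * j := by omega
  rw [this, pow_add, pow_mul]
  simp

/-! ### The determinant and its recursion -/

/-- The determinant `det (x_j ^ (n - i) - x_j ^ (m + i - 1))`, `1 ≤ i, j ≤ n`, written with the
variables indexing the rows. For `m = n + p` it is the numerator in Weyl's character formula for
the weight `(p / 2, …, p / 2)` of `Spin(2 n + 1)`, up to sign and a monomial factor. -/
def weylNumerator {R : Type*} [CommRing R] {n : ℕ} (x : Fin n → R) (m : ℕ) : R :=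
  Matrix.det (Matrix.of fun j k : Fin n => x j ^ (k.rev : ℕ) - x j ^ (m + (k : ℕ)))

section weylNumerator

variable {R : Type*} [CommRing R] {n : ℕ}

/-- The first column of the matrix is zero: both exponents in it are `n`. -/
theorem weylNumerator_succ_self (x : Fin (n + 1) → R) : weylNumerator x n = 0 := by
  refine Matrix.det_eq_zero_of_column_eq_zero 0 fun j => ?_
  simp [Fin.val_rev]

/-- The product `∏ (y_i - y_j)` over `i < j`, where `y_j` is `x_j` or, if `ε j`, its inverse,
cleared of denominators: each inverted variable contributes a factor `x_j ^ (n - 1)`. -/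
def flipVandermonde (x : Fin n → R) (ε : Fin n → Bool) : R :=
  ∏ i, ∏ j ∈ Finset.Ioi i,
    ((if ε j then x j else 1) * (if ε i then 1 else x i) -
      (if ε i then x i else 1) * (if ε j then 1 else x j))

/-- Expansion of `weylNumerator` by multilinearity in the rows; each term is the determinant of a
projective Vandermonde matrix. -/
theorem weylNumerator_eq_sum (x : Fin n → R) (m : ℕ) :
    weylNumerator x m =
      ∑ ε : Fin n → Bool, (∏ i, if ε i then -x i ^ m else 1) * flipVandermonde x ε := by
  classical
  let g : Fin n → Bool → Fin n → R := fun j b k =>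
    (if b then -x j ^ m else 1) * ((if b then x j else 1) ^ (k : ℕ) *
      (if b then 1 else x j) ^ (k.rev : ℕ))
  have h1 : weylNumerator x m =
      Matrix.detRowAlternating.toMultilinearMap fun j => ∑ b : Bool, g j b := by
    refine congrArg Matrix.det ?_
    ext j k
    simp only [Matrix.of_apply, Fintype.sum_bool, g, Pi.add_apply]
    simp
    ring
  rw [h1, MultilinearMap.map_sum]
  refine Finset.sum_congr rfl fun ε _ => ?_
  have h2 : (fun j => g j (ε j)) = fun j => (if ε j then -x j ^ m else 1) •
      Matrix.projVandermonde (fun j => if ε j then x j else 1)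
        (fun j => if ε j then 1 else x j) j := by
    ext j k
    simp [g, Matrix.projVandermonde_apply]
  rw [h2, flipVandermonde, ← Matrix.det_projVandermonde (fun j => if ε j then x j else 1)
    fun j => if ε j then 1 else x j]
  exact MultilinearMap.map_smul_univ _ _ _

theorem flipVandermonde_succAbove (x : Fin (n + 1) → R) (ε : Fin (n + 1) → Bool)
    (j : Fin (n + 1)) (hj : ε j = false) :
    flipVandermonde x ε = (-1) ^ (n + (j : ℕ)) *
      (∏ i, ((if ε (j.succAbove i) then 1 else x (j.succAbove i)) -
        (if ε (j.succAbove i) then x (j.succAbove i) else 1) * x j)) *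
      flipVandermonde (fun i => x (j.succAbove i)) fun i => ε (j.succAbove i) := by
  rw [flipVandermonde, Fin.prod_prod_Ioi_succAbove _ j, ← Fin.prod_ite_succAbove_lt,
    ← Finset.prod_mul_distrib (f := fun i => if j.succAbove i < j then (1 : R) else -1)]
  refine congrArg₂ (fun a b : R => a * b) (Finset.prod_congr rfl fun i _ => ?_) rfl
  simp only [hj, Bool.false_eq_true, if_false]
  split_ifs <;> ring

/-- A choice of `j` and of `ε` on the complement of `j` is a choice of `ε` on all indices together
with some `j` such that `ε j = false`. -/
theorem Fin.sum_sum_succAbove_bool {M : Type*} [AddCommMonoid M]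
    (F : Fin (n + 1) → (Fin n → Bool) → M) :
    ∑ j, ∑ ε, F j ε =
      ∑ ε : Fin (n + 1) → Bool, ∑ j with ε j = false, F j fun i => ε (j.succAbove i) := by
  simp only [Finset.sum_filter]
  conv_rhs => rw [Finset.sum_comm]
  refine Finset.sum_congr rfl fun j _ => ?_
  rw [← (Fin.insertNthEquiv (fun _ => Bool) j).sum_comp, Fintype.sum_prod_type, Fintype.sum_bool]
  simp [Fin.insertNthEquiv]

end weylNumerator

/-- Conditions on field elements under which no denominator of the bounded Littlewood identity,
and of the partial fraction identity behind it, vanishes. -/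
structure IsGenericTuple {K : Type*} [Field K] {n : ℕ} (x : Fin n → K) : Prop where
  injective : Function.Injective x
  ne_zero : ∀ i, x i ≠ 0
  mul_ne_one : ∀ i j, x i * x j ≠ 1

section Field

variable {K : Type*} [Field K] {n : ℕ}

theorem IsGenericTuple.comp_succAbove {x : Fin (n + 1) → K} (hx : IsGenericTuple x)
    (j : Fin (n + 1)) : IsGenericTuple fun i => x (j.succAbove i) where
  injective := hx.injective.comp Fin.succAbove_right_injective
  ne_zero _ := hx.ne_zero _
  mul_ne_one _ _ := hx.mul_ne_one _ _

theorem IsGenericTuple.ne_neg_one {x : Fin n → K} (hx : IsGenericTuple x) (i : Fin n) :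
    x i ≠ -1 := fun h => hx.mul_ne_one i i (by simp [h])

theorem IsGenericTuple.ne_one {x : Fin n → K} (hx : IsGenericTuple x) (i : Fin n) :
    x i ≠ 1 := fun h => hx.mul_ne_one i i (by simp [h])

theorem Finset.sum_one_sub_mul_prod_div_sub_of_injective {ι : Type*} [DecidableEq ι]
    (T : Finset ι) (x : ι → K) (hx : Function.Injective x) (h0 : ∀ i, x i ≠ 0)
    (h1 : ∀ i, x i ≠ -1) :
    ∑ j ∈ T, (1 - x j) * ∏ i ∈ T.erase j, (x i * (1 - x i * x j) / (x i - x j)) =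
      1 - ∏ i ∈ T, x i := by
  classical
  have := Finset.sum_one_sub_mul_prod_div_sub (T.image x) (by simp [h0]) (by simp [h1])
  rw [Finset.sum_image hx.injOn, Finset.prod_image hx.injOn] at this
  rw [← this]
  refine Finset.sum_congr rfl fun j _ => ?_
  rw [← Finset.image_erase hx, Finset.prod_image hx.injOn]

/-- The recursion for `weylNumerator` that matches the Laplace expansion of the alternants in
`genAlternant_succ`. After expansion over `ε` it holds term by term, by the partial fraction
identity for the set `T` of variables that are not inverted. -/
theorem weylNumerator_succ_sub {x : Fin (n + 1) → K} (hx : IsGenericTuple x) (m : ℕ) :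
    weylNumerator x (m + 1) - (∏ i, x i) * weylNumerator x m =
      ∑ j : Fin (n + 1), (-1) ^ (n + (j : ℕ)) *
        ((∏ i, x (j.succAbove i)) * ((1 - x j) * ∏ i, (1 - x (j.succAbove i) * x j)) *
          weylNumerator (fun i => x (j.succAbove i)) m) := by
  simp only [weylNumerator_eq_sum, Finset.mul_sum]
  rw [Fin.sum_sum_succAbove_bool fun j ε => (-1) ^ (n + (j : ℕ)) *
        ((∏ i, x (j.succAbove i)) * ((1 - x j) * ∏ i, (1 - x (j.succAbove i) * x j)) *
          ((∏ i, if ε i then -x (j.succAbove i) ^ m else 1) *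
            flipVandermonde (fun i => x (j.succAbove i)) ε)), ← Finset.sum_sub_distrib]
  refine Finset.sum_congr rfl fun ε _ => ?_
  set T : Finset (Fin (n + 1)) := {j | ε j = false} with hT
  set c := ∏ i, if ε i then -x i ^ m else 1 with hc
  have hsplit : ∀ h : Fin (n + 1) → K, ∏ i, h i = (∏ i with ε i = true, h i) * ∏ i ∈ T, h i :=
    fun h => by
      rw [← Finset.prod_filter_mul_prod_filter_not _ (fun i => ε i = true) h]
      simp [hT]
  have hc1 : (∏ i, if ε i then -x i ^ (m + 1) else 1) = c * ∏ i with ε i = true, x i := by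
    rw [hc, Finset.prod_filter, ← Finset.prod_mul_distrib]
    refine Finset.prod_congr rfl fun i _ => ?_
    split_ifs <;> ring
  -- the factors that belong to inverted variables cancel, so only a product over `T` remains
  have hterm : ∀ j ∈ T, (-1) ^ (n + (j : ℕ)) *
        ((∏ i, x (j.succAbove i)) * ((1 - x j) * ∏ i, (1 - x (j.succAbove i) * x j)) *
          ((∏ i, if ε (j.succAbove i) then -x (j.succAbove i) ^ m else 1) *
            flipVandermonde (fun i => x (j.succAbove i)) fun i => ε (j.succAbove i))) =
      c * flipVandermonde x ε * (∏ i with ε i = true, x i) *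
        ((1 - x j) * ∏ i ∈ T.erase j, (x i * (1 - x i * x j) / (x i - x j))) := by
    intro j hj
    have hj' : ε j = false := by simpa [hT] using hj
    set h : Fin (n + 1) → K := fun i =>
      x i * (1 - x i * x j) / ((if ε i then 1 else x i) - (if ε i then x i else 1) * x j) with hh
    have hd : ∀ i, i ≠ j → (if ε i then 1 else x i) - (if ε i then x i else 1) * x j ≠ 0 := by
      intro i hi
      split_ifs
      · exact sub_ne_zero.2 (hx.mul_ne_one i j).symm
      · simpa using sub_ne_zero.2 (hx.injective.ne hi)
    have hcj : c = ∏ i, if ε (j.succAbove i) then -x (j.succAbove i) ^ m else 1 := by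
      rw [hc, Fin.prod_univ_succAbove _ j]
      simp [hj']
    have hprod : (∏ i with ε i = true, x i) *
        ∏ i ∈ T.erase j, (x i * (1 - x i * x j) / (x i - x j)) = ∏ i, h (j.succAbove i) := by
      have h1 : ∏ i, h (j.succAbove i) = ∏ i, if i = j then 1 else h i := by
        rw [Fin.prod_univ_succAbove _ j]
        simp [Fin.succAbove_ne]
      rw [h1, hsplit]
      refine congrArg₂ (· * ·) (Finset.prod_congr rfl fun i hi => ?_) ?_
      · have hi' : ε i = true := by simpa using hi
        have hij : i ≠ j := by rintro rfl; simp [hi'] at hj'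
        have := hd i hij
        simp only [hi', if_true] at this
        simp only [hij, if_false, hh, hi', if_true]
        field_simp
      · rw [← Finset.mul_prod_erase T _ hj, if_pos rfl, one_mul]
        refine Finset.prod_congr rfl fun i hi => ?_
        have hi' : ε i = false := by simpa [hT] using Finset.mem_of_mem_erase hi
        simp [Finset.ne_of_mem_erase hi, hh, hi']
    rw [flipVandermonde_succAbove x ε j hj', ← hcj]
    have hne : ∏ i, ((if ε (j.succAbove i) then 1 else x (j.succAbove i)) -
        (if ε (j.succAbove i) then x (j.succAbove i) else 1) * x j) ≠ 0 :=
      Finset.prod_ne_zero_iff.2 fun i _ => hd _ (Fin.succAbove_ne j i)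
    rw [mul_assoc _ (∏ i with ε i = true, x i), mul_left_comm (∏ i with ε i = true, x i), hprod]
    simp only [hh, Finset.prod_div_distrib, Finset.prod_mul_distrib]
    generalize ∏ i, ((if ε (j.succAbove i) then 1 else x (j.succAbove i)) -
        (if ε (j.succAbove i) then x (j.succAbove i) else 1) * x j) = P at hne ⊢
    rcases neg_one_pow_eq_or K (n + (j : ℕ)) with h | h <;> rw [h] <;> field_simp
  rw [Finset.sum_congr rfl hterm, ← Finset.mul_sum,
    Finset.sum_one_sub_mul_prod_div_sub_of_injective T x hx.injective hx.ne_zero hx.ne_neg_one,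
    hc1, hsplit x]
  ring

end Field

/-! ### Young diagrams in a box -/

namespace YoungDiagram

theorem ext_rowLen {μ ν : YoungDiagram} (h : ∀ i, μ.rowLen i = ν.rowLen i) : μ = ν := by
  ext ⟨i, j⟩
  rw [mem_cells, mem_cells, mem_iff_lt_rowLen, mem_iff_lt_rowLen, h]

theorem rowLen_eq_of_mem_iff {μ : YoungDiagram} {i k : ℕ} (h : ∀ j, (i, j) ∈ μ ↔ j < k) :
    μ.rowLen i = k :=
  eq_of_forall_lt_iff fun j => by rw [← mem_iff_lt_rowLen, h]

theorem rowLen_eq_zero_iff {μ : YoungDiagram} {n : ℕ} : μ.rowLen n = 0 ↔ μ.colLen 0 ≤ n := by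
  rw [← not_lt, ← mem_iff_lt_colLen, mem_iff_lt_rowLen, Nat.pos_iff_ne_zero, not_not]

theorem finite_setOf_colLen_le_rowLen_le (n p : ℕ) :
    {ν : YoungDiagram | ν.colLen 0 ≤ n ∧ ν.rowLen 0 ≤ p}.Finite := by
  refine Set.Finite.of_finite_image (f := cells)
    ((Finset.range n ×ˢ Finset.range p).powerset.finite_toSet.subset ?_)
    (fun μ _ ν _ h => YoungDiagram.ext h)
  rintro _ ⟨ν, ⟨h1, h2⟩, rfl⟩
  simp only [Finset.coe_powerset, Set.mem_preimage, Set.mem_powerset_iff, Finset.coe_subset]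
  rintro ⟨i, j⟩ hc
  rw [mem_cells] at hc
  have h3 := mem_iff_lt_colLen.1 (ν.up_left_mem le_rfl (Nat.zero_le j) hc)
  have h4 := mem_iff_lt_rowLen.1 (ν.up_left_mem (Nat.zero_le i) le_rfl hc)
  simp only [Finset.mem_product, Finset.mem_range]
  omega

/-- The finite set of diagrams with at most `n` rows and at most `p` columns. -/
noncomputable def inBox (n p : ℕ) : Finset YoungDiagram :=
  (finite_setOf_colLen_le_rowLen_le n p).toFinset

theorem mem_inBox {n p : ℕ} {ν : YoungDiagram} :
    ν ∈ inBox n p ↔ ν.rowLen n = 0 ∧ ν.rowLen 0 ≤ p := by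
  simp [inBox, rowLen_eq_zero_iff]

theorem inBox_zero (p : ℕ) : inBox 0 p = {⊥} := by
  have hbot : (⊥ : YoungDiagram).rowLen 0 = 0 := rowLen_eq_of_mem_iff (by simp)
  ext ν
  rw [mem_inBox, Finset.mem_singleton]
  constructor
  · rintro ⟨h, -⟩
    refine ext_rowLen fun i => ?_
    have h1 := ν.rowLen_anti 0 i (Nat.zero_le i)
    have h2 := (⊥ : YoungDiagram).rowLen_anti 0 i (Nat.zero_le i)
    omega
  · rintro rfl
    omega

/-- Keep the first `n` rows of `ν` and make each of them longer by one box; rows that `ν` lacks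
count as rows of length `0`. -/
def addColumn (n : ℕ) (ν : YoungDiagram) : YoungDiagram where
  cells := (Finset.range n ×ˢ Finset.range (ν.rowLen 0 + 1)).filter
    fun c => c.2 < ν.rowLen c.1 + 1
  isLowerSet := by
    rintro ⟨i, j⟩ ⟨i', j'⟩ ⟨h1, h2⟩ h
    simp only [Finset.coe_filter, Finset.mem_product, Finset.mem_range, Set.mem_ofPred_eq] at *
    have h3 := ν.rowLen_anti i' i h1
    omega

theorem rowLen_addColumn (n : ℕ) (ν : YoungDiagram) (i : ℕ) :
    (ν.addColumn n).rowLen i = if i < n then ν.rowLen i + 1 else 0 := by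
  refine rowLen_eq_of_mem_iff fun j => ?_
  have h3 := ν.rowLen_anti 0 i (Nat.zero_le i)
  rw [← mem_cells]
  simp only [addColumn, Finset.mem_filter, Finset.mem_product, Finset.mem_range]
  split_ifs <;> omega

/-- Delete the first column. -/
def removeColumn (ν : YoungDiagram) : YoungDiagram where
  cells := ν.cells.filter fun c => c.2 < ν.rowLen c.1 - 1
  isLowerSet := by
    rintro ⟨i, j⟩ ⟨i', j'⟩ ⟨h1, h2⟩ h
    simp only [Finset.coe_filter, mem_cells, mem_iff_lt_rowLen, Set.mem_ofPred_eq] at *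
    have h3 := ν.rowLen_anti i' i h1
    omega

theorem rowLen_removeColumn (ν : YoungDiagram) (i : ℕ) :
    ν.removeColumn.rowLen i = ν.rowLen i - 1 := by
  refine rowLen_eq_of_mem_iff fun j => ?_
  rw [← mem_cells]
  simp only [removeColumn, Finset.mem_filter, mem_cells, mem_iff_lt_rowLen]
  omega

theorem filter_inBox_succ (n p : ℕ) :
    (inBox (n + 1) p).filter (fun ν => ν.rowLen n = 0) = inBox n p := by
  ext ν
  have := ν.rowLen_anti n (n + 1) (Nat.le_succ n)
  simp only [Finset.mem_filter, mem_inBox]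
  omega

/-- A diagram with at most `n + 1` rows either has at most `n` rows or arises from a narrower one
by adding a column of length `n + 1`. -/
theorem sum_inBox_succ_succ {M : Type*} [AddCommMonoid M] (n p : ℕ) (f : YoungDiagram → M) :
    ∑ ν ∈ inBox (n + 1) (p + 1), f ν =
      ∑ ν ∈ inBox (n + 1) p, f (ν.addColumn (n + 1)) + ∑ ν ∈ inBox n (p + 1), f ν := by
  rw [← Finset.sum_filter_add_sum_filter_not _ (fun ν => ν.rowLen n = 0), filter_inBox_succ,
    add_comm]
  congr 1
  have hl : ∀ ν ∈ (inBox (n + 1) (p + 1)).filter (fun ν => ¬ ν.rowLen n = 0),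
      ν.removeColumn.addColumn (n + 1) = ν := by
    intro ν hν
    simp only [Finset.mem_filter, mem_inBox] at hν
    refine ext_rowLen fun i => ?_
    rw [rowLen_addColumn, rowLen_removeColumn]
    split_ifs with hi
    · have := ν.rowLen_anti i n (by omega)
      omega
    · have := ν.rowLen_anti (n + 1) i (by omega)
      omega
  refine Finset.sum_nbij' removeColumn (addColumn (n + 1)) ?_ ?_ hl ?_ ?_
  · intro ν hν
    simp only [Finset.mem_filter, mem_inBox, rowLen_removeColumn] at hν ⊢
    omega
  · intro ν hν
    simp only [Finset.mem_filter, mem_inBox, rowLen_addColumn] at hν ⊢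
    simp
    omega
  · intro ν hν
    simp only [mem_inBox] at hν
    refine ext_rowLen fun i => ?_
    rw [rowLen_removeColumn, rowLen_addColumn]
    split_ifs with hi
    · omega
    · have := ν.rowLen_anti (n + 1) i (by omega)
      omega
  · intro ν hν
    rw [hl ν hν]

end YoungDiagram

/-! ### The bounded Littlewood identity -/

/-- The alternant `det (x_j ^ (ν_i + n - i))` of arbitrary ring elements. -/
def genAlternant {R : Type*} [CommRing R] {n : ℕ} (x : Fin n → R) (ν : YoungDiagram) : R :=
  Matrix.det (Matrix.of fun i j : Fin n => x j ^ (ν.rowLen i + (n - 1 - (i : ℕ))))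

/-- The denominator `∏ (1 - x_i) * ∏ (1 - x_i x_j)` of the bounded Littlewood identity. -/
def littlewoodDenom {R : Type*} [CommRing R] {n : ℕ} (x : Fin n → R) : R :=
  (∏ i, (1 - x i)) * ∏ i, ∏ j ∈ Finset.Ioi i, (1 - x i * x j)

section CommRing

variable {R : Type*} [CommRing R] {n : ℕ}

theorem genAlternant_addColumn (x : Fin (n + 1) → R) (ν : YoungDiagram) :
    genAlternant x (ν.addColumn (n + 1)) = (∏ i, x i) * genAlternant x ν := by
  rw [genAlternant, genAlternant, ← Matrix.det_mul_row]
  refine congrArg Matrix.det ?_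
  ext i j
  simp only [Matrix.of_apply, YoungDiagram.rowLen_addColumn, if_pos i.2]
  ring

/-- Laplace expansion along the last row, which consists of ones. -/
theorem genAlternant_succ (x : Fin (n + 1) → R) {ν : YoungDiagram} (h : ν.rowLen n = 0) :
    genAlternant x ν = ∑ j : Fin (n + 1), (-1) ^ (n + (j : ℕ)) *
      ((∏ i, x (j.succAbove i)) * genAlternant (fun i => x (j.succAbove i)) ν) := by
  rw [genAlternant, Matrix.det_succ_row _ (Fin.last n)]
  refine Finset.sum_congr rfl fun j _ => ?_
  rw [genAlternant, ← Matrix.det_mul_row, mul_assoc]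
  simp only [Matrix.of_apply, Fin.val_last, h, Nat.add_sub_cancel, Nat.sub_self, add_zero, pow_zero,
    one_mul]
  refine congrArg (fun d : R => _ * d) (congrArg Matrix.det ?_)
  ext i k
  simp only [Matrix.submatrix_apply, Matrix.of_apply, Fin.succAbove_last, Fin.val_castSucc]
  rw [← pow_succ']
  congr 1
  omega

theorem littlewoodDenom_succAbove (x : Fin (n + 1) → R) (j : Fin (n + 1)) :
    littlewoodDenom x = ((1 - x j) * ∏ i, (1 - x (j.succAbove i) * x j)) *
      littlewoodDenom fun i => x (j.succAbove i) := by
  have h : ∀ i, (if j.succAbove i < j then 1 - x (j.succAbove i) * x j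
      else 1 - x j * x (j.succAbove i)) = 1 - x (j.succAbove i) * x j := fun i => by
    split_ifs <;> ring
  rw [littlewoodDenom, littlewoodDenom, Fin.prod_univ_succAbove _ j,
    Fin.prod_prod_Ioi_succAbove _ j, Finset.prod_congr rfl fun i _ => h i]
  ring

end CommRing

/-- Macdonald's bounded Littlewood identity, which writes the sum of the Schur polynomials of all
diagrams inside an `n × p` rectangle as a quotient, with denominators cleared. -/
theorem sum_genAlternant_mul_littlewoodDenom {K : Type*} [Field K] {n : ℕ} {x : Fin n → K}
    (hx : IsGenericTuple x) (p : ℕ) :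
    (∑ ν ∈ YoungDiagram.inBox n p, genAlternant x ν) * littlewoodDenom x =
      weylNumerator x (n + p) := by
  induction n generalizing p with
  | zero => simp [YoungDiagram.inBox_zero, genAlternant, littlewoodDenom, weylNumerator]
  | succ n ih =>
    have step : ∀ p, (∑ ν ∈ YoungDiagram.inBox n p, genAlternant x ν) * littlewoodDenom x =
        weylNumerator x (n + p + 1) - (∏ i, x i) * weylNumerator x (n + p) := by
      intro p
      rw [weylNumerator_succ_sub hx, Finset.sum_congr rfl fun ν hν =>
        genAlternant_succ x (YoungDiagram.mem_inBox.1 hν).1, Finset.sum_comm, Finset.sum_mul]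
      refine Finset.sum_congr rfl fun j _ => ?_
      rw [← ih (hx.comp_succAbove j) p, littlewoodDenom_succAbove x j, ← Finset.mul_sum,
        ← Finset.mul_sum]
      ring
    induction p with
    | zero =>
      have h0 : YoungDiagram.inBox (n + 1) 0 = YoungDiagram.inBox n 0 := by
        rw [← YoungDiagram.filter_inBox_succ n 0, Finset.filter_true_of_mem]
        intro ν hν
        have := ν.rowLen_anti 0 n (Nat.zero_le n)
        have := (YoungDiagram.mem_inBox.1 hν).2
        omega
      -- the term that a box with `p = -1` columns would contribute is zero
      rw [h0, step, add_zero, weylNumerator_succ_self, mul_zero, sub_zero]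
    | succ p ihp =>
      rw [YoungDiagram.sum_inBox_succ_succ, add_mul, step]
      simp only [genAlternant_addColumn]
      rw [← Finset.mul_sum, mul_assoc, ihp, show n + (p + 1) = n + 1 + p by ring,
        show n + 1 + (p + 1) = n + 1 + p + 1 by ring]
      ring

/-! ### Self-conjugate diagrams and their first hooks -/

namespace YoungDiagram

theorem card_eq_sum_rowLen {μ : YoungDiagram} {n : ℕ} (h : μ.rowLen n = 0) :
    μ.card = ∑ i ∈ Finset.range n, μ.rowLen i := by
  rw [YoungDiagram.card, Finset.card_eq_sum_card_fiberwise (f := Prod.fst) (t := Finset.range n)]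
  · exact Finset.sum_congr rfl fun i _ => (μ.rowLen_eq_card).symm
  · rintro ⟨i, j⟩ hc
    have h1 := mem_iff_lt_rowLen.1 ((mem_cells _).1 (Finset.mem_coe.1 hc))
    simp only [Finset.coe_range, Set.mem_Iio]
    by_contra hi
    have := μ.rowLen_anti n i (not_lt.1 hi)
    omega

theorem diagRank_eq_sum {μ : YoungDiagram} {n : ℕ} (h : μ.rowLen n = 0) :
    μ.diagRank = ∑ i ∈ Finset.range n, if i < μ.rowLen i then 1 else 0 := by
  rw [← Finset.card_filter, diagRank]
  refine Finset.card_nbij' Prod.fst (fun i => (i, i)) ?_ ?_ ?_ ?_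
  · rintro ⟨i, j⟩ hc
    simp only [Finset.coe_filter, mem_cells, Set.mem_ofPred_eq, mem_iff_lt_rowLen,
      Finset.mem_range] at hc ⊢
    obtain ⟨hc, rfl⟩ := hc
    refine ⟨?_, hc⟩
    by_contra hi
    have := μ.rowLen_anti n i (not_lt.1 hi)
    omega
  · intro i hi
    simpa [mem_iff_lt_rowLen] using (Finset.mem_filter.1 hi).2
  · rintro ⟨i, j⟩ hc
    simp only [Finset.coe_filter, Set.mem_ofPred_eq] at hc
    simp [hc.2]
  · intro i _
    rfl

open Classical in
/-- The self-conjugate diagrams with at most `n` rows. -/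
noncomputable def selfConj (n : ℕ) : Finset YoungDiagram :=
  (inBox n n).filter fun μ => μ.transpose = μ

theorem mem_selfConj {n : ℕ} {μ : YoungDiagram} :
    μ ∈ selfConj n ↔ μ.rowLen n = 0 ∧ μ.transpose = μ := by
  simp only [selfConj, Finset.mem_filter, mem_inBox]
  refine ⟨fun h => ⟨h.1.1, h.2⟩, fun h => ⟨⟨h.1, ?_⟩, h.2⟩⟩
  rw [← colLen_transpose, h.2, ← rowLen_eq_zero_iff]
  exact h.1

theorem rowLen_le_of_mem_selfConj {n : ℕ} {μ : YoungDiagram} (h : μ ∈ selfConj n) (i : ℕ) :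
    μ.rowLen i ≤ n :=
  (μ.rowLen_anti 0 i (Nat.zero_le i)).trans (by
    simp only [selfConj, Finset.mem_filter, mem_inBox] at h
    exact h.1.2)

/-- The part of `μ` inside the `n × n` square, moved by `(1, 1)`, together with a hook whose arm
and leg both have length `n`. -/
def addHook (n : ℕ) (μ : YoungDiagram) : YoungDiagram where
  cells := (Finset.range (n + 1) ×ˢ Finset.range (n + 1)).filter
    fun c => c.1 = 0 ∨ c.2 = 0 ∨ (c.1 - 1, c.2 - 1) ∈ μ
  isLowerSet := by
    rintro ⟨i, j⟩ ⟨i', j'⟩ ⟨h1, h2⟩ h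
    simp only [Finset.coe_filter, Finset.mem_product, Finset.mem_range, Set.mem_ofPred_eq] at *
    have h3 := μ.up_left_mem (i1 := i' - 1) (i2 := i - 1) (j1 := j' - 1) (j2 := j - 1)
      (by omega) (by omega)
    refine ⟨by omega, ?_⟩
    rcases h.2 with h4 | h4 | h4
    · omega
    · omega
    · exact Or.inr (Or.inr (h3 h4))

theorem mem_addHook {n : ℕ} {μ : YoungDiagram} {i j : ℕ} :
    (i, j) ∈ μ.addHook n ↔
      (i < n + 1 ∧ j < n + 1) ∧ (i = 0 ∨ j = 0 ∨ (i - 1, j - 1) ∈ μ) := by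
  rw [← mem_cells]
  simp [addHook]

theorem transpose_addHook {n : ℕ} {μ : YoungDiagram} (h : μ.transpose = μ) :
    (μ.addHook n).transpose = μ.addHook n := by
  ext ⟨i, j⟩
  rw [mem_cells, mem_cells, mem_transpose, Prod.swap_prod_mk, mem_addHook, mem_addHook]
  nth_rewrite 1 [← h]
  rw [mem_transpose, Prod.swap_prod_mk]
  tauto

theorem rowLen_addHook_zero (n : ℕ) (μ : YoungDiagram) : (μ.addHook n).rowLen 0 = n + 1 :=
  rowLen_eq_of_mem_iff fun j => by rw [mem_addHook]; simp

theorem rowLen_addHook_succ {n : ℕ} {μ : YoungDiagram} (h : μ ∈ selfConj n) (i : ℕ) :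
    (μ.addHook n).rowLen (i + 1) = if i < n then μ.rowLen i + 1 else 0 := by
  have h1 := rowLen_le_of_mem_selfConj h i
  have h2 : n ≤ i → μ.rowLen i = 0 := fun hi =>
    Nat.le_zero.1 ((mem_selfConj.1 h).1 ▸ μ.rowLen_anti n i hi)
  refine rowLen_eq_of_mem_iff fun j => ?_
  rw [mem_addHook, Nat.add_sub_cancel, mem_iff_lt_rowLen]
  have h3 : i + 1 ≠ 0 := Nat.succ_ne_zero i
  have h4 : (j = 0 ∨ j - 1 < μ.rowLen i) ↔ j < μ.rowLen i + 1 := by omega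
  rw [or_iff_right h3, h4]
  split_ifs <;> omega

/-- Delete the first row and the first column. -/
def removeHook (μ : YoungDiagram) : YoungDiagram where
  cells := μ.cells.filter fun c => (c.1 + 1, c.2 + 1) ∈ μ
  isLowerSet := by
    rintro ⟨i, j⟩ ⟨i', j'⟩ ⟨h1, h2⟩ h
    simp only [Finset.coe_filter, mem_cells, Set.mem_ofPred_eq] at *
    exact ⟨μ.up_left_mem h1 h2 h.1,
      μ.up_left_mem (Nat.succ_le_succ h1) (Nat.succ_le_succ h2) h.2⟩

theorem mem_removeHook {μ : YoungDiagram} {i j : ℕ} :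
    (i, j) ∈ μ.removeHook ↔ (i + 1, j + 1) ∈ μ := by
  rw [← mem_cells]
  simp only [removeHook, Finset.mem_filter, mem_cells, and_iff_right_iff_imp]
  exact μ.up_left_mem (Nat.le_succ i) (Nat.le_succ j)

theorem rowLen_removeHook (μ : YoungDiagram) (i : ℕ) :
    μ.removeHook.rowLen i = μ.rowLen (i + 1) - 1 :=
  rowLen_eq_of_mem_iff fun j => by
    rw [mem_removeHook, mem_iff_lt_rowLen]
    omega

theorem transpose_removeHook {μ : YoungDiagram} (h : μ.transpose = μ) :
    μ.removeHook.transpose = μ.removeHook := by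
  ext ⟨i, j⟩
  rw [mem_cells, mem_cells, mem_transpose, Prod.swap_prod_mk, mem_removeHook, mem_removeHook]
  nth_rewrite 1 [← h]
  rw [mem_transpose, Prod.swap_prod_mk]

/-- A self-conjugate diagram with at most `n + 1` rows either has at most `n` rows or arises from
such a diagram by adding a first hook of length `2 n + 1`. -/
theorem sum_selfConj_succ {M : Type*} [AddCommMonoid M] (n : ℕ) (f : YoungDiagram → M) :
    ∑ μ ∈ selfConj (n + 1), f μ =
      ∑ μ ∈ selfConj n, f μ + ∑ μ ∈ selfConj n, f (μ.addHook n) := by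
  rw [← Finset.sum_filter_add_sum_filter_not _ (fun μ => μ.rowLen n = 0)]
  refine congrArg₂ (fun a b : M => a + b) (Finset.sum_congr ?_ fun _ _ => rfl) ?_
  · ext μ
    have := μ.rowLen_anti n (n + 1) (Nat.le_succ n)
    simp only [Finset.mem_filter, mem_selfConj]
    refine ⟨fun h => ⟨h.2, h.1.2⟩, fun h => ⟨⟨by omega, h.2⟩, h.1⟩⟩
  have hr : ∀ μ ∈ (selfConj (n + 1)).filter (fun μ => ¬ μ.rowLen n = 0),
      μ.removeHook ∈ selfConj n := by
    intro μ hμ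
    simp only [Finset.mem_filter, mem_selfConj] at hμ ⊢
    exact ⟨by rw [rowLen_removeHook]; omega, transpose_removeHook hμ.1.2⟩
  have hl : ∀ μ ∈ (selfConj (n + 1)).filter (fun μ => ¬ μ.rowLen n = 0),
      μ.removeHook.addHook n = μ := by
    intro μ hμ
    have hm := hr μ hμ
    have hle := rowLen_le_of_mem_selfConj (Finset.mem_filter.1 hμ).1 0
    simp only [Finset.mem_filter, mem_selfConj] at hμ
    refine ext_rowLen fun i => ?_
    cases i with
    | zero =>
      have h1 : (n, 0) ∈ μ := mem_iff_lt_rowLen.2 (by omega)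
      rw [← hμ.1.2, mem_transpose] at h1
      have h2 : n < μ.rowLen 0 := mem_iff_lt_rowLen.1 h1
      rw [rowLen_addHook_zero]
      omega
    | succ i =>
      rw [rowLen_addHook_succ hm, rowLen_removeHook]
      split_ifs with hi
      · have := μ.rowLen_anti (i + 1) n (by omega)
        omega
      · have := μ.rowLen_anti (n + 1) (i + 1) (by omega)
        omega
  refine Finset.sum_nbij' removeHook (addHook n) hr ?_ hl ?_ ?_
  · intro μ hμ
    have h1 := mem_selfConj.1 hμ
    rw [Finset.mem_filter, mem_selfConj]
    refine ⟨⟨?_, transpose_addHook h1.2⟩, ?_⟩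
    · rw [rowLen_addHook_succ hμ, if_neg (lt_irrefl n)]
    · cases n with
      | zero => simp [rowLen_addHook_zero]
      | succ n => simp [rowLen_addHook_succ hμ]
  · intro μ hμ
    have h1 := (mem_selfConj.1 hμ).1
    refine ext_rowLen fun i => ?_
    rw [rowLen_removeHook, rowLen_addHook_succ hμ]
    split_ifs with hi
    · omega
    · have := μ.rowLen_anti n i (by omega)
      omega
  · intro μ hμ
    rw [hl μ hμ]

/-- Adding a first hook multiplies the sign `(-1) ^ ((|μ| + r) / 2)` by `(-1) ^ (n + 1)`. -/
theorem card_add_diagRank_addHook {n : ℕ} {μ : YoungDiagram} (h : μ ∈ selfConj n) :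
    (μ.addHook n).card + (μ.addHook n).diagRank = μ.card + μ.diagRank + 2 * (n + 1) := by
  have h0 := (mem_selfConj.1 h).1
  have h1 : (μ.addHook n).rowLen (n + 1) = 0 := by
    rw [rowLen_addHook_succ h, if_neg (lt_irrefl n)]
  rw [card_eq_sum_rowLen h1, diagRank_eq_sum h1, card_eq_sum_rowLen h0, diagRank_eq_sum h0,
    Finset.sum_range_succ', Finset.sum_range_succ' (fun i => if i < _ then 1 else 0),
    rowLen_addHook_zero, if_pos (Nat.succ_pos n)]
  have h2 : ∀ i ∈ Finset.range n, (μ.addHook n).rowLen (i + 1) = μ.rowLen i + 1 := fun i hi => by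
    rw [rowLen_addHook_succ h, if_pos (Finset.mem_range.1 hi)]
  have h3 : ∀ i ∈ Finset.range n, (if i + 1 < (μ.addHook n).rowLen (i + 1) then 1 else 0) =
      if i < μ.rowLen i then 1 else 0 := fun i hi => by
    rw [h2 i hi]
    simp
  rw [Finset.sum_congr rfl h2, Finset.sum_congr rfl h3, Finset.sum_add_distrib]
  simp
  ring

end YoungDiagram

/-! ### Expansion over self-conjugate diagrams -/

open YoungDiagram in
/-- Expansion of an alternating map by multilinearity, with the arguments of each term put into
the order given by a self-conjugate diagram `μ = (α | α)`: the arguments `k ∈ α` at which `v` is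
chosen come first, in decreasing order. The sign `(-1) ^ ((|μ| + r) / 2)` combines `(-1) ^ r` with
the sign `(-1) ^ (∑ k ∈ α, k)` of the sorting permutation. -/
theorem AlternatingMap.map_sub_eq_sum_selfConj {R M N : Type*} [CommRing R] [AddCommGroup M]
    [Module R M] [AddCommGroup N] [Module R N] (u v : ℕ → M) {n : ℕ} (f : M [⋀^Fin n]→ₗ[R] N) :
    (f fun k => u k - v k) = ∑ μ ∈ selfConj n, (-1 : ℤ) ^ ((μ.card + μ.diagRank) / 2) •
      f fun i => if (i : ℕ) < μ.rowLen i then v (μ.rowLen i - (i + 1)) else u (i - μ.rowLen i) := by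
  induction n with
  | zero =>
    have h : selfConj 0 = {⊥} := by
      ext μ
      simp only [selfConj, inBox_zero, Finset.mem_filter, Finset.mem_singleton,
        and_iff_left_iff_imp]
      rintro rfl
      ext ⟨i, j⟩
      simp [mem_transpose]
    have h1 : (⊥ : YoungDiagram).card = 0 := rfl
    have h2 : (⊥ : YoungDiagram).diagRank = 0 := rfl
    rw [h, Finset.sum_singleton, h1, h2]
    simp only [add_zero, Nat.zero_div, pow_zero, one_smul]
    exact congrArg f (Subsingleton.elim _ _)
  | succ n ih =>
    have hf : ∀ (y : M) (w : Fin n → M),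
        f ((Fin.last n).insertNth y w) = (-1 : ℤ) ^ n • f.curryLeft y w := by
      intro y w
      rw [f.map_insertNth, Fin.val_last]
      rfl
    have hsplit : (fun k : Fin (n + 1) => u k - v k) =
        (Fin.last n).insertNth (u n - v n) fun k : Fin n => u k - v k := by
      rw [Fin.eq_insertNth_iff]
      refine ⟨by simp, ?_⟩
      ext k
      simp [Fin.removeNth]
    rw [hsplit, hf, map_sub, AlternatingMap.sub_apply, ih, ih, smul_sub, Finset.smul_sum,
      Finset.smul_sum, sub_eq_add_neg, ← Finset.sum_neg_distrib, sum_selfConj_succ]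
    refine congrArg₂ (fun a b : N => a + b) (Finset.sum_congr rfl fun μ hμ => ?_)
      (Finset.sum_congr rfl fun μ hμ => ?_)
    · have h0 := (mem_selfConj.1 hμ).1
      rw [smul_comm, ← hf]
      refine congrArg (fun z : N => _ • z) (congrArg f ?_)
      symm
      rw [Fin.eq_insertNth_iff]
      refine ⟨by simp [h0], ?_⟩
      ext k
      simp [Fin.removeNth]
    · have hs : (μ.card + μ.diagRank + 2 * (n + 1)) / 2 = (μ.card + μ.diagRank) / 2 + n + 1 := by
        omega
      rw [card_add_diagRank_addHook hμ, hs, smul_smul, ← neg_smul]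
      refine congrArg₂ (fun (a : ℤ) (z : N) => a • z) (by ring) (congrArg f ?_)
      funext i
      refine Fin.cases ?_ (fun i => ?_) i
      · simp [rowLen_addHook_zero]
      · simp [rowLen_addHook_succ hμ]

open YoungDiagram in
/-- The numerator on the left-hand side of the identity: when `μ` chooses the second monomial for
`k = μ_i - (i + 1)`, the exponent `n + p + k` is that of row `i` of the alternant of `μ^(p)`. -/
theorem weylNumerator_eq_sum_selfConj {R : Type*} [CommRing R] {n : ℕ} (x : Fin n → R) (p : ℕ) :
    weylNumerator x (n + p) = ∑ μ ∈ selfConj n,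
      (-1) ^ ((μ.card + μ.diagRank) / 2) * genAlternant x (μ.armAugment p) := by
  rw [weylNumerator, ← Matrix.det_transpose]
  have h := (Matrix.detRowAlternating (R := R) (n := Fin n)).map_sub_eq_sum_selfConj
    (fun k j => x j ^ (n - (k + 1))) (fun k j => x j ^ (n + p + k))
  refine Eq.trans ?_ (h.trans (Finset.sum_congr rfl fun μ _ => ?_))
  · refine congrArg Matrix.det ?_
    ext k j
    simp [Fin.val_rev]
  · rw [zsmul_eq_mul]
    push_cast
    refine congrArg (fun z : R => _ * z) (congrArg Matrix.det ?_)
    ext i j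
    simp only [Matrix.of_apply, rowLen_armAugment, mem_iff_lt_rowLen]
    have := i.2
    split_ifs with hi
    · show x j ^ _ = x j ^ _
      congr 1
      omega
    · show x j ^ _ = x j ^ _
      congr 1
      omega

/-! ### Schur polynomials in the field of rational functions -/

theorem isGenericTuple_ratVar (n : ℕ) : IsGenericTuple (ratVar n) := by
  have hi : Function.Injective (algebraMap (MvPolynomial (Fin n) ℤ) (RatFunField n)) :=
    IsFractionRing.injective _ _
  refine ⟨fun a b h => MvPolynomial.X_injective (hi h), fun i h => ?_, fun i j h => ?_⟩
  · exact MvPolynomial.X_ne_zero i (hi (h.trans (map_zero _).symm))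
  · rw [ratVar, ratVar, ← map_mul,
      ← map_one (algebraMap (MvPolynomial (Fin n) ℤ) (RatFunField n))] at h
    -- evaluation of `x_i * x_j = 1` at the origin
    simpa using congrArg (MvPolynomial.eval fun _ => (0 : ℤ)) (hi h)

theorem IsGenericTuple.littlewoodDenom_ne_zero {K : Type*} [Field K] {n : ℕ} {x : Fin n → K}
    (hx : IsGenericTuple x) : littlewoodDenom x ≠ 0 :=
  mul_ne_zero (Finset.prod_ne_zero_iff.2 fun i _ => sub_ne_zero.2 (hx.ne_one i).symm)
    (Finset.prod_ne_zero_iff.2 fun i _ => Finset.prod_ne_zero_iff.2 fun j _ =>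
      sub_ne_zero.2 (hx.mul_ne_one i j).symm)

theorem schurPoly_eq_zero {n : ℕ} {ν : YoungDiagram} (h : ν.rowLen n ≠ 0) : schurPoly n ν = 0 :=
  if_neg (mt YoungDiagram.rowLen_eq_zero_iff.2 h)

theorem schurPoly_eq_div {n : ℕ} {ν : YoungDiagram} (h : ν.rowLen n = 0) :
    schurPoly n ν = genAlternant (ratVar n) ν / alternant n ⊥ :=
  if_pos (YoungDiagram.rowLen_eq_zero_iff.1 h)

theorem YoungDiagram.rowLen_armAugment_eq_zero_iff {p : ℕ} {μ : YoungDiagram} {i : ℕ} :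
    (μ.armAugment p).rowLen i = 0 ↔ μ.rowLen i = 0 := by
  rw [rowLen_armAugment]
  split_ifs with h
  · have := mem_iff_lt_rowLen.1 h
    omega
  · simp

theorem theorem4 (n p : ℕ) :
    {μ : YoungDiagram | μ.transpose = μ ∧ schurPoly n (μ.armAugment p) ≠ 0}.Finite ∧
    {ν : YoungDiagram | ν.rowLen 0 ≤ p ∧ schurPoly n ν ≠ 0}.Finite ∧
    (∑ᶠ (μ : YoungDiagram) (_ : μ.transpose = μ),
        (-1 : RatFunField n) ^ ((μ.card + μ.diagRank) / 2) * schurPoly n (μ.armAugment p)) /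
      ((∏ i : Fin n, (1 - ratVar n i)) *
        ∏ i : Fin n, ∏ j ∈ Finset.Ioi i, (1 - ratVar n i * ratVar n j)) =
    ∑ᶠ (ν : YoungDiagram) (_ : ν.rowLen 0 ≤ p), schurPoly n ν := by
  have h1 : ∀ μ : YoungDiagram, schurPoly n (μ.armAugment p) ≠ 0 → μ.rowLen n = 0 :=
    fun μ h => YoungDiagram.rowLen_armAugment_eq_zero_iff.1 (not_not.1 (mt schurPoly_eq_zero h))
  have h2 : ∀ ν : YoungDiagram, schurPoly n ν ≠ 0 → ν.rowLen n = 0 :=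
    fun ν h => not_not.1 (mt schurPoly_eq_zero h)
  refine ⟨(YoungDiagram.selfConj n).finite_toSet.subset fun μ h =>
      YoungDiagram.mem_selfConj.2 ⟨h1 μ h.2, h.1⟩,
    (YoungDiagram.inBox n p).finite_toSet.subset fun ν h =>
      YoungDiagram.mem_inBox.2 ⟨h2 ν h.2, h.1⟩, ?_⟩
  rw [finsum_cond_eq_sum_of_cond_iff (t := YoungDiagram.selfConj n) _ fun {μ} h => ?_,
    finsum_cond_eq_sum_of_cond_iff (t := YoungDiagram.inBox n p) _ fun {ν} h => ?_]
  · have hx := isGenericTuple_ratVar n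
    have hl : ∀ μ ∈ YoungDiagram.selfConj n,
        (-1 : RatFunField n) ^ ((μ.card + μ.diagRank) / 2) * schurPoly n (μ.armAugment p) =
          (-1) ^ ((μ.card + μ.diagRank) / 2) * genAlternant (ratVar n) (μ.armAugment p) /
            alternant n ⊥ := fun μ hμ => by
      rw [schurPoly_eq_div (YoungDiagram.rowLen_armAugment_eq_zero_iff.2
        (YoungDiagram.mem_selfConj.1 hμ).1), mul_div_assoc]
    rw [Finset.sum_congr rfl hl, ← Finset.sum_div, ← weylNumerator_eq_sum_selfConj,
      ← sum_genAlternant_mul_littlewoodDenom hx,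
      Finset.sum_congr rfl fun ν hν => schurPoly_eq_div (YoungDiagram.mem_inBox.1 hν).1,
      ← Finset.sum_div, mul_div_right_comm]
    exact mul_div_cancel_right₀ _ hx.littlewoodDenom_ne_zero
  · rw [YoungDiagram.mem_inBox, and_iff_right (h2 ν h)]
  · rw [YoungDiagram.mem_selfConj, and_iff_right (h1 μ (right_ne_zero_of_mul h))]
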